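/- Let $n\ge 0$. There is a constant $C(n)\ge 0$, depending only on $n$, with the following property. Let $M$ be a smooth closed (compact, without boundary) manifold of dimension $n$, and let $\mathcal M$ be the set of smooth Riemannian metrics on $M$, an open subset of the Fréchet space $\mathcal S$ of smooth symmetric $(0,2)$-tensor fields on $M$ with the $C^\infty$ topology. For $g\in\mathcal M$ let $\mu_g$ be the Riemannian volume measure of $g$, write $\mathrm{Vol}(A,g)=\mu_g(A)$, and for $h,k\in\mathcal S$ put $$(h,k)_g=\int_M \operatorname{tr}(g^{-1}hg^{-1}k)\,d\mu_g ,\qquad \|h\|_g=\sqrt{(h,h)_g}.$$ Let $d(g_0,g_1)$ be the infimum of the lengths $\int_a^b\|\dot\gamma(t)\|_{\gamma(t)}\,dt$ over all piecewise $C^1$ paths $\gamma:[a,b]\to\mathcal M$ from $g_0$ to $g_1$. Then for all $g_0,g_1\in\mathcal M$, with $E=\{x\in M : g_0(x)\neq g_1(x)\}$, $$d(g_0,g_1)\le C(n)\left(\sqrt{\mathrm{Vol}(E,g_0)}+\sqrt{\mathrm{Vol}(E,g_1)}\right).$$ In particular, for every real $\delta\ge 0$, $$\operatorname{diam}_d\{g\in\mathcal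 M : \mathrm{Vol}(M,g)\le\delta\}\le 2C(n)\sqrt{\delta}.$$ -/

import Mathlib

open Set Filter Topology MeasureTheory Bundle Manifold
open scoped ENNReal NNReal ContDiff

noncomputable section

namespace L2Metric

section Tensors

variable (n : ℕ) (M : Type*) [TopologicalSpace M] [ChartedSpace (EuclideanSpace ℝ (Fin n)) M]
  [IsManifold (𝓡 n) ∞ M]

/-- The space of smooth Riemannian metrics on `M` (Mathlib's smooth Riemannian metrics on the
tangent bundle). -/
abbrev Metrics : Type _ :=
  ContMDiffRiemannianMetric (𝓡 n) ∞ (EuclideanSpace ℝ (Fin n))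
    (fun x : M => TangentSpace (𝓡 n) x)

/-- The fibre at `x` of the bundle of `(0,2)`-tensors: the bilinear forms on `T_x M`. -/
abbrev TensorFiber (x : M) : Type _ :=
  TangentSpace (𝓡 n) x →L[ℝ] TangentSpace (𝓡 n) x →L[ℝ] ℝ

set_option synthInstance.maxHeartbeats 200000 in
instance (x : M) : AddCommGroup (TensorFiber n M x) := inferInstance

set_option synthInstance.maxHeartbeats 200000 in
instance (x : M) : Module ℝ (TensorFiber n M x) := inferInstance

set_option synthInstance.maxHeartbeats 200000 in
/-- The vector space of all smooth `(0,2)`-tensor fields on `M`. -/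
abbrev Tensors : Type _ :=
  ContMDiffSection (𝓡 n) (EuclideanSpace ℝ (Fin n) →L[ℝ] EuclideanSpace ℝ (Fin n) →L[ℝ] ℝ) ∞
    (TensorFiber n M)

set_option synthInstance.maxHeartbeats 200000 in
instance : AddCommGroup (Tensors n M) := inferInstance

set_option synthInstance.maxHeartbeats 200000 in
instance : Module ℝ (Tensors n M) := inferInstance

/-- The vector space of smooth symmetric `(0,2)`-tensor fields on `M`, i.e. the smooth sections
of `S²T*M`. -/
def SymTensors : Submodule ℝ (Tensors n M) where
  carrier := {h | ∀ (x : M) (v w : TangentSpace (𝓡 n) x), h x v w = h x w v}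
  add_mem' := by
    intro a b ha hb x v w
    simp [ha x v w, hb x v w]
  zero_mem' := by
    intro x v w
    simp
  smul_mem' := by
    intro r a ha x v w
    simp [ha x v w]

variable {n M}

/-- A smooth Riemannian metric, viewed as an element of the vector space of smooth symmetric
`(0,2)`-tensor fields. -/
def Metrics.toSym (g : Metrics n M) : SymTensors n M :=
  ⟨⟨g.inner, g.contMDiff⟩, g.symm⟩

/-- The `i`-th coordinate vector field `∂/∂xⁱ` of the chart `chartAt _ c`, at the point `x`
of the domain of this chart. -/
def coordVector (c x : M) (i : Fin n) : TangentSpace (𝓡 n) x :=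
  (trivializationAt (EuclideanSpace ℝ (Fin n)) (fun y : M => TangentSpace (𝓡 n) y) c).symmL ℝ x
    (EuclideanSpace.basisFun (Fin n) ℝ i)

/-- The matrix of coefficients `B(∂/∂xⁱ, ∂/∂xʲ)` of a bilinear form `B` on `T_x M`, in the
coordinates of the chart `chartAt _ c`. -/
def coordMatrix (c : M) {x : M}
    (B : TangentSpace (𝓡 n) x →L[ℝ] TangentSpace (𝓡 n) x →L[ℝ] ℝ) :
    Matrix (Fin n) (Fin n) ℝ :=
  Matrix.of fun i j => B (coordVector c x i) (coordVector c x j)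

/-- The coefficient `h_ij` of a tensor field in the chart `chartAt _ c`, as a function on the
image of this chart in `ℝⁿ`. -/
def coordCoeff (c : M) (i j : Fin n) (h : Tensors n M) (y : EuclideanSpace ℝ (Fin n)) : ℝ :=
  coordMatrix c (h ((chartAt (EuclideanSpace ℝ (Fin n)) c).symm y)) i j

/-- The compact subsets of the image in `ℝⁿ` of the chart `chartAt _ c`. -/
def chartCompacts (c : M) : Set (Set (EuclideanSpace ℝ (Fin n))) :=
  {K | IsCompact K ∧ K ⊆ (chartAt (EuclideanSpace ℝ (Fin n)) c).target}

/-- The `C^∞` (Fréchet) topology on smooth tensor fields: uniform convergence, on all compact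
subsets of charts, of all partial derivatives of all coefficients. -/
instance tensorsTopology : TopologicalSpace (Tensors n M) :=
  ⨅ (c : M) (i : Fin n) (j : Fin n) (k : ℕ),
    TopologicalSpace.induced
      (fun h => UniformOnFun.ofFun (chartCompacts c) (iteratedFDeriv ℝ k (coordCoeff c i j h)))
      inferInstance

/-- `tr_g(hk) = tr(g⁻¹ h g⁻¹ k)` at the point `x`, computed in the coordinates of the preferred
chart around `x` (the value does not depend on the coordinates). -/
def trInner (g : Metrics n M) (h k : SymTensors n M) (x : M) : ℝ :=
  Matrix.trace ((coordMatrix x (g.inner x))⁻¹ * coordMatrix x (h.1 x) *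
    (coordMatrix x (g.inner x))⁻¹ * coordMatrix x (k.1 x))

end Tensors

section Volume

variable {n : ℕ} {M : Type*} [TopologicalSpace M] [ChartedSpace (EuclideanSpace ℝ (Fin n)) M]

variable (n M) in
/-- A compact manifold is covered by finitely many compact sets, each of which is contained in
the domain of a preferred chart. -/
theorem exists_chart_cover [CompactSpace M] :
    ∃ s : (N : ℕ) × (Fin N → M × Set M),
      (∀ k, IsCompact (s.2 k).2 ∧
        (s.2 k).2 ⊆ (chartAt (EuclideanSpace ℝ (Fin n)) (s.2 k).1).source) ∧
      ∀ x : M, ∃ k, x ∈ (s.2 k).2 := by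
  have : LocallyCompactSpace M :=
    ChartedSpace.locallyCompactSpace (EuclideanSpace ℝ (Fin n)) M
  have hK : ∀ c : M, ∃ K : Set M, IsCompact K ∧ c ∈ interior K ∧
      K ⊆ (chartAt (EuclideanSpace ℝ (Fin n)) c).source := fun c =>
    exists_compact_subset (chartAt (EuclideanSpace ℝ (Fin n)) c).open_source
      (mem_chart_source _ c)
  choose K hKc hKi hKs using hK
  obtain ⟨t, ht⟩ := isCompact_univ.elim_finite_subcover (fun c : M => interior (K c))
    (fun c => isOpen_interior) (fun x _ => mem_iUnion.2 ⟨x, hKi x⟩)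
  refine ⟨⟨t.card, fun k => ((t.equivFin.symm k : M), K (t.equivFin.symm k : M))⟩,
    fun k => ⟨hKc _, hKs _⟩, fun x => ?_⟩
  obtain ⟨c, hc, hx⟩ := mem_iUnion₂.1 (ht (mem_univ x))
  exact ⟨t.equivFin ⟨c, hc⟩, by simpa using interior_subset hx⟩

variable (n M) in
/-- The number of sets in a fixed finite cover of `M` by compact subsets of chart domains. -/
def numCharts [CompactSpace M] : ℕ := (exists_chart_cover n M).choose.1

variable (n M) in
/-- The centres of the charts that belong to the fixed finite cover. -/
def chartCenter [CompactSpace M] (k : Fin (numCharts n M)) : M :=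
  ((exists_chart_cover n M).choose.2 k).1

variable (n M) in
/-- The compact sets of the fixed finite cover. -/
def chartCompact [CompactSpace M] (k : Fin (numCharts n M)) : Set M :=
  ((exists_chart_cover n M).choose.2 k).2

variable (n M) in
theorem isCompact_chartCompact [CompactSpace M] (k : Fin (numCharts n M)) :
    IsCompact (chartCompact n M k) :=
  ((exists_chart_cover n M).choose_spec.1 k).1

variable (n M) in
theorem chartCompact_subset_source [CompactSpace M] (k : Fin (numCharts n M)) :
    chartCompact n M k ⊆ (chartAt (EuclideanSpace ℝ (Fin n)) (chartCenter n M k)).source :=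
  ((exists_chart_cover n M).choose_spec.1 k).2

variable (n M) in
theorem chartCompact_cover [CompactSpace M] (x : M) :
    ∃ k : Fin (numCharts n M), x ∈ chartCompact n M k :=
  (exists_chart_cover n M).choose_spec.2 x

variable (n M) in
/-- The points that lie in the `k`-th set of the fixed finite cover but in no earlier one.
These sets form a finite Borel partition of `M`. -/
def chartPiece [CompactSpace M] (k : Fin (numCharts n M)) : Set M :=
  {x | x ∈ chartCompact n M k ∧ ∀ j < k, x ∉ chartCompact n M j}

/-- The Lebesgue measure `dx¹ ⋯ dxⁿ` of the chart `chartAt _ c`, as a measure on `M`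
concentrated on the domain of the chart. -/
def chartLebesgue [MeasurableSpace M] (c : M) : Measure M :=
  ((volume : Measure (EuclideanSpace ℝ (Fin n))).restrict
    (chartAt (EuclideanSpace ℝ (Fin n)) c).target).map
      (chartAt (EuclideanSpace ℝ (Fin n)) c).symm

/-- The Riemannian volume measure `μ_g`, i.e. the measure given by `√det(g_ij) dx¹ ⋯ dxⁿ` in
every chart. It is computed on each piece of the partition `chartPiece` in the chart that belongs
to the piece; by the change of variables formula, it does not depend on the partition or on the
charts. -/
def riemannianVolume [IsManifold (𝓡 n) ∞ M] [CompactSpace M] [MeasurableSpace M]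
    (g : Metrics n M) : Measure M :=
  Measure.sum fun k : Fin (numCharts n M) =>
    ((chartLebesgue (n := n) (chartCenter n M k)).restrict (chartPiece n M k)).withDensity
      fun x => ENNReal.ofReal (Real.sqrt (coordMatrix (chartCenter n M k) (g.inner x)).det)

end Volume

section Distance

variable {n : ℕ} {M : Type*} [TopologicalSpace M] [ChartedSpace (EuclideanSpace ℝ (Fin n)) M]
  [IsManifold (𝓡 n) ∞ M]

/-- A piecewise `C¹` path in the space of smooth Riemannian metrics, an open subset of the
Fréchet space of smooth symmetric `(0,2)`-tensor fields: the parameter interval `[a, b]` is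
divided into finitely many closed intervals, on each of which the path has a derivative `v`
(one-sided at the ends) that is continuous, all with respect to the `C^∞` topology.
`velocity` is this derivative away from the division points; its values at the division points
are immaterial. -/
structure PiecewiseC1Path (g₀ g₁ : Metrics n M) where
  a : ℝ
  b : ℝ
  a_le_b : a ≤ b
  toFun : ℝ → Metrics n M
  velocity : ℝ → SymTensors n M
  source : toFun a = g₀
  target : toFun b = g₁
  piecewise_C1 : ∃ (N : ℕ) (τ : ℕ → ℝ), τ 0 = a ∧ τ N = b ∧ ∀ i < N, τ i ≤ τ (i + 1) ∧
    ∃ v : ℝ → SymTensors n M, ContinuousOn v (Icc (τ i) (τ (i + 1))) ∧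
      (∀ t ∈ Icc (τ i) (τ (i + 1)),
        Tendsto (fun s : ℝ => (s - t)⁻¹ • ((toFun s).toSym - (toFun t).toSym))
          (𝓝[Icc (τ i) (τ (i + 1)) \ {t}] t) (𝓝 (v t))) ∧
      EqOn velocity v (Ioo (τ i) (τ (i + 1)))

variable [CompactSpace M] [MeasurableSpace M]

/-- The `L²` metric `(h, k)_g = ∫_M tr_g(hk) dμ_g` on the space of Riemannian metrics. -/
def l2Inner (g : Metrics n M) (h k : SymTensors n M) : ℝ :=
  ∫ x, trInner g h k x ∂(riemannianVolume g)

/-- The norm induced by the `L²` metric. -/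
def l2Norm (g : Metrics n M) (h : SymTensors n M) : ℝ :=
  Real.sqrt (l2Inner g h h)

/-- The length of a path with respect to the `L²` metric. -/
def PiecewiseC1Path.length {g₀ g₁ : Metrics n M} (γ : PiecewiseC1Path g₀ g₁) : ℝ≥0∞ :=
  ∫⁻ t in Icc γ.a γ.b, ENNReal.ofReal (l2Norm (γ.toFun t) (γ.velocity t))

/-- The distance function (a pseudometric) induced by the `L²` metric: the infimum of the lengths
of piecewise `C¹` paths. -/
def l2Dist (g₀ g₁ : Metrics n M) : ℝ≥0∞ :=
  ⨅ γ : PiecewiseC1Path g₀ g₁, γ.length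

/-- The diameter of a set of Riemannian metrics with respect to the distance induced by the `L²`
metric. -/
def l2Diam (S : Set (Metrics n M)) : ℝ≥0∞ :=
  ⨆ (g₀ ∈ S) (g₁ ∈ S), l2Dist g₀ g₁

end Distance

end L2Metric

end

/-!
Let `E` be the set where `g₀` and `g₁` differ. The distance estimate comes from the degeneracy of
the `L²` metric: where a metric is almost zero, moving it costs almost nothing, since the volume
form scales like `ψ ^ (n / 2)` under `g ↦ ψ g` while the trace in the `L²` metric is scale
invariant.

The set `E` is open and the volume measures are finite, so there is a smooth function `φ` with
values in `[0, 1]`, supported in `E`, that equals `1` on a closed set `K ⊆ E` for which `E \ K` has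
small volume (`exists_cutoff`). For a small `s > 0` put `ψ = 1 + (s⁴ - 1)φ`. The path from `g₀` to
`g₁` consists of three curves (`l2Dist_le_of_cutoff`).

* From `g₀` to `ψ g₀` along `(1 + (τ⁴ - 1)φ) g₀`, where `τ` decreases from `1` to `s`. The fourth
  power makes the squared speed at most `16 n Vol(E, g₀)` in every dimension `n ≥ 1`
  (`scaling_density_le`, `ofReal_l2Norm_scaling_le`).
* From `ψ g₀` to `ψ g₁` along the segment. By compactness, the traces and the volume densities of
  the segment from `g₀` to `g₁` are bounded (`exists_segment_bound`), so the squared speed is at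
  most a constant times the integral of `√ψ` over `E`
  (`exists_lintegral_trInner_segment_le`). This integral is at most
  `s² Vol(M, g₀) + Vol(E \ K, g₀)`, which is as small as desired.
* From `ψ g₁` to `g₁`, as in the first step backwards.

Hence `C = 4 √n` is admissible. All curves have the form `p + c(t) q` with fixed tensor fields `p`
and `q`, so that their differentiability in the `C^∞` topology reduces to the continuity of
`r ↦ r q` (`continuous_smul_tensors`, `l2Dist_le_sum`). In dimension `0` there is only one metric.
-/

namespace L2Metric

/-! ### Coordinates of tensors -/

section Coordinates

variable {n : ℕ} {M : Type*} [TopologicalSpace M] [ChartedSpace (EuclideanSpace ℝ (Fin n)) M]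
  [IsManifold (𝓡 n) ∞ M]

theorem mem_baseSet_tangent {c x : M} (hx : x ∈ (chartAt (EuclideanSpace ℝ (Fin n)) c).source) :
    x ∈ (trivializationAt (EuclideanSpace ℝ (Fin n))
      (fun y : M => TangentSpace (𝓡 n) y) c).baseSet := by
  rwa [TangentBundle.trivializationAt_baseSet]

/-- The coordinate vectors of the chart `chartAt _ c` form a basis of the tangent space at every
point of the domain of the chart. -/
noncomputable def coordBasis (c x : M)
    (hx : x ∈ (chartAt (EuclideanSpace ℝ (Fin n)) c).source) :
    Module.Basis (Fin n) ℝ (TangentSpace (𝓡 n) x) :=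
  (trivializationAt (EuclideanSpace ℝ (Fin n)) (fun y : M => TangentSpace (𝓡 n) y) c).basisAt
    (EuclideanSpace.basisFun (Fin n) ℝ).toBasis (mem_baseSet_tangent hx)

theorem coordBasis_apply {c x : M} (hx : x ∈ (chartAt (EuclideanSpace ℝ (Fin n)) c).source)
    (i : Fin n) : coordBasis c x hx i = coordVector c x i := by
  simp only [coordBasis, coordVector, Bundle.Trivialization.basisAt, Module.Basis.map_apply,
    OrthonormalBasis.coe_toBasis]
  rw [Bundle.Trivialization.symmL_apply (hb := mem_baseSet_tangent hx)]
  simp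

theorem coordMatrix_eq_toMatrix₂ {c x : M}
    (hx : x ∈ (chartAt (EuclideanSpace ℝ (Fin n)) c).source) (B : TensorFiber n M x) :
    coordMatrix c B = LinearMap.toMatrix₂ (coordBasis c x hx) (coordBasis c x hx)
      (LinearMap.mk₂ ℝ (fun v w => B v w) (by simp) (by simp) (by simp) (by simp)) := by
  ext i j
  simp [coordMatrix, LinearMap.toMatrix₂_apply, coordBasis_apply]

/-- The coefficient matrices of a bilinear form in two charts are congruent. -/
theorem exists_coordMatrix_eq_congr {c c' x : M}
    (hx : x ∈ (chartAt (EuclideanSpace ℝ (Fin n)) c).source)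
    (hx' : x ∈ (chartAt (EuclideanSpace ℝ (Fin n)) c').source) :
    ∃ P : Matrix (Fin n) (Fin n) ℝ, IsUnit P.det ∧
      ∀ B : TensorFiber n M x, coordMatrix c' B = P.transpose * coordMatrix c B * P := by
  refine ⟨(coordBasis c x hx).toMatrix (coordBasis c' x hx'), ?_, fun B => ?_⟩
  · rw [← Matrix.isUnit_iff_isUnit_det]
    exact @isUnit_of_invertible _ _ _ (Module.Basis.invertibleToMatrix _ _)
  · rw [coordMatrix_eq_toMatrix₂ hx, coordMatrix_eq_toMatrix₂ hx',
      LinearMap.toMatrix₂_mul_basis_toMatrix]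

theorem coordMatrix_injOn {c x : M} (hx : x ∈ (chartAt (EuclideanSpace ℝ (Fin n)) c).source)
    {B B' : TensorFiber n M x} (h : coordMatrix c B = coordMatrix c B') : B = B' := by
  rw [coordMatrix_eq_toMatrix₂ hx, coordMatrix_eq_toMatrix₂ hx,
    EmbeddingLike.apply_eq_iff_eq] at h
  ext v w
  exact congr($h v w)

theorem coordMatrix_add {c x : M} (B B' : TensorFiber n M x) :
    coordMatrix c (B + B') = coordMatrix c B + coordMatrix c B' := by
  ext i j
  simp [coordMatrix]

theorem coordMatrix_sub {c x : M} (B B' : TensorFiber n M x) :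
    coordMatrix c (B - B') = coordMatrix c B - coordMatrix c B' := by
  ext i j
  simp [coordMatrix]

theorem coordMatrix_smul {c x : M} (r : ℝ) (B : TensorFiber n M x) :
    coordMatrix c (r • B) = r • coordMatrix c B := by
  ext i j
  simp [coordMatrix]

theorem coordMatrix_posDef {c x : M} (hx : x ∈ (chartAt (EuclideanSpace ℝ (Fin n)) c).source)
    (g : Metrics n M) : (coordMatrix c (g.inner x)).PosDef := by
  refine Matrix.PosDef.of_dotProduct_mulVec_pos ?_ fun v hv => ?_
  · ext i j
    simp [coordMatrix, g.symm x (coordVector c x i)]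
  · have h0 : ∑ i, v i • coordVector c x i ≠ 0 := by
      intro h
      refine hv (funext fun i => ?_)
      refine Fintype.linearIndependent_iff.1 (coordBasis c x hx).linearIndependent v ?_ i
      simpa [coordBasis_apply] using h
    have := g.pos x _ h0
    rw [g.symm] at this
    simpa [coordMatrix, dotProduct, Matrix.mulVec, Finset.mul_sum, mul_comm, mul_left_comm,
      g.symm x] using this

theorem det_coordMatrix_pos {c x : M} (hx : x ∈ (chartAt (EuclideanSpace ℝ (Fin n)) c).source)
    (g : Metrics n M) : 0 < (coordMatrix c (g.inner x)).det :=
  (coordMatrix_posDef hx g).det_pos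

theorem contMDiffOn_coordVector (c : M) (i : Fin n) :
    ContMDiffOn (𝓡 n) ((𝓡 n).prod 𝓘(ℝ, EuclideanSpace ℝ (Fin n))) ∞
      (fun x => TotalSpace.mk' (EuclideanSpace ℝ (Fin n)) x (coordVector c x i))
      (chartAt (EuclideanSpace ℝ (Fin n)) c).source := by
  have := (trivializationAt (EuclideanSpace ℝ (Fin n))
    (fun y : M => TangentSpace (𝓡 n) y) c).contMDiffOn_localFrame_baseSet (I := 𝓡 n) ∞
      (EuclideanSpace.basisFun (Fin n) ℝ).toBasis i
  rw [TangentBundle.trivializationAt_baseSet] at this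
  refine this.congr fun x hx => ?_
  rw [Bundle.Trivialization.localFrame_apply_of_mem_baseSet (hx := mem_baseSet_tangent hx)]
  exact congrArg _ (coordBasis_apply hx i).symm

theorem contMDiffOn_coordMatrix (c : M) (i j : Fin n) (h : Tensors n M) :
    ContMDiffOn (𝓡 n) 𝓘(ℝ, ℝ) ∞ (fun x => coordMatrix c (h x) i j)
      (chartAt (EuclideanSpace ℝ (Fin n)) c).source := by
  intro x hx
  have h1 := h.contMDiff.contMDiffOn (s := (chartAt (EuclideanSpace ℝ (Fin n)) c).source) x hx
  have h2 := (contMDiffOn_coordVector c i x hx)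
  have h3 := (contMDiffOn_coordVector c j x hx)
  have := (h1.clm_bundle_apply (E₂ := fun x : M => TangentSpace (𝓡 n) x →L[ℝ] ℝ) h2)
  have := ContMDiffWithinAt.clm_bundle_apply (E₂ := fun x : M => ℝ) this h3
  rw [contMDiffWithinAt_section] at this
  simpa [coordMatrix] using this

theorem continuousOn_coordMatrix (c : M) (h : Tensors n M) :
    ContinuousOn (fun x => coordMatrix c (h x))
      (chartAt (EuclideanSpace ℝ (Fin n)) c).source :=
  continuousOn_pi.2 fun i => continuousOn_pi.2 fun j =>
    (contMDiffOn_coordMatrix c i j h).continuousOn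

theorem contDiffOn_coordCoeff (c : M) (i j : Fin n) (h : Tensors n M) :
    ContDiffOn ℝ ∞ (coordCoeff c i j h) (chartAt (EuclideanSpace ℝ (Fin n)) c).target := by
  rw [← contMDiffOn_iff_contDiffOn]
  exact (contMDiffOn_coordMatrix c i j h).comp (contMDiffOn_chart_symm (I := 𝓡 n) (x := c))
    fun y hy => (chartAt (EuclideanSpace ℝ (Fin n)) c).map_target hy

theorem coordCoeff_smul (c : M) (i j : Fin n) (r : ℝ) (h : Tensors n M) :
    coordCoeff c i j (r • h) = r • coordCoeff c i j h := by
  ext y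
  simp [coordCoeff, coordMatrix]

end Coordinates

/-! ### Smooth metrics and affine curves of tensor fields -/

set_option synthInstance.maxHeartbeats 200000 in
/-- A positive definite form on a finite-dimensional space has a bounded unit ball. -/
theorem isVonNBounded_of_pos {n : ℕ}
    (B : EuclideanSpace ℝ (Fin n) →L[ℝ] EuclideanSpace ℝ (Fin n) →L[ℝ] ℝ)
    (hB : ∀ v, v ≠ 0 → 0 < B v v) :
    Bornology.IsVonNBounded ℝ {v : EuclideanSpace ℝ (Fin n) | B v v < 1} := by
  rw [NormedSpace.isVonNBounded_iff]
  obtain ⟨a, ha, hS⟩ := (isCompact_sphere (0 : EuclideanSpace ℝ (Fin n)) 1).exists_forall_le'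
    (f := fun v => B v v) (a := 0) (B.continuous.clm_apply continuous_id).continuousOn
    fun v hv => hB v fun h0 => by
      have h1 : ‖v‖ = 1 := mem_sphere_zero_iff_norm.1 hv
      simp [h0] at h1
  refine (Metric.isBounded_iff_subset_closedBall 0).2 ⟨√(1 / a), fun v hv => ?_⟩
  rw [mem_closedBall_zero_iff]
  rcases eq_or_ne v 0 with rfl | hv0
  · simp
  have hn : 0 < ‖v‖ := norm_pos_iff.2 hv0
  have h1 := hS (‖v‖⁻¹ • v) (by simp [norm_smul, hn.ne'])
  have h2 : B v v < 1 := hv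
  simp only [map_smul, smul_apply, smul_eq_mul] at h1
  refine Real.le_sqrt_of_sq_le ?_
  rw [le_div_iff₀ ha]
  have : a * ‖v‖ ^ 2 ≤ B v v := by
    calc a * ‖v‖ ^ 2 ≤ (‖v‖⁻¹ * (‖v‖⁻¹ * B v v)) * ‖v‖ ^ 2 := by gcongr
      _ = B v v := by field_simp
  linarith

section Curves

variable {n : ℕ} {M : Type*} [TopologicalSpace M] [ChartedSpace (EuclideanSpace ℝ (Fin n)) M]
  [IsManifold (𝓡 n) ∞ M]

/-- Scalar multiplication is continuous in the scalar for the `C^∞` topology. Joint continuity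
is not needed, because only curves in one-dimensional affine subspaces occur. -/
theorem continuous_smul_tensors (h : Tensors n M) : Continuous fun r : ℝ => r • h := by
  refine continuous_iInf_rng.2 fun c => continuous_iInf_rng.2 fun i =>
    continuous_iInf_rng.2 fun j => continuous_iInf_rng.2 fun k => ?_
  rw [continuous_induced_rng, continuous_iff_continuousAt]
  intro r₀
  rw [ContinuousAt, UniformOnFun.tendsto_iff_tendstoUniformlyOn]
  intro K hK
  have ho := (chartAt (EuclideanSpace ℝ (Fin n)) c).open_target
  have hcd := contDiffOn_coordCoeff c i j h
  have hcont : ContinuousOn (iteratedFDeriv ℝ k (coordCoeff c i j h)) K := by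
    refine ContinuousOn.mono ?_ hK.2
    refine ContinuousOn.congr (f := iteratedFDerivWithin ℝ k (coordCoeff c i j h)
      (chartAt (EuclideanSpace ℝ (Fin n)) c).target) ?_
      fun y hy => (iteratedFDerivWithin_of_isOpen k ho hy).symm
    exact hcd.continuousOn_iteratedFDerivWithin (by exact_mod_cast le_top) ho.uniqueDiffOn
  obtain ⟨b, hb⟩ := hK.1.exists_bound_of_continuousOn hcont
  have hsmul : ∀ (r : ℝ), ∀ y ∈ K, iteratedFDeriv ℝ k (coordCoeff c i j (r • h)) y =
      r • iteratedFDeriv ℝ k (coordCoeff c i j h) y := by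
    intro r y hy
    rw [coordCoeff_smul]
    exact iteratedFDeriv_const_smul_apply
      (((hcd y (hK.2 hy)).contDiffAt (ho.mem_nhds (hK.2 hy))).of_le (by exact_mod_cast le_top))
  rw [Metric.tendstoUniformlyOn_iff]
  intro ε hε
  have hb1 : 0 < |b| + 1 := by positivity
  filter_upwards [Metric.ball_mem_nhds r₀ (div_pos hε hb1)] with r hr y hy
  change dist (iteratedFDeriv ℝ k (coordCoeff c i j (r₀ • h)) y)
    (iteratedFDeriv ℝ k (coordCoeff c i j (r • h)) y) < ε
  rw [hsmul _ _ hy, hsmul _ _ hy, dist_eq_norm, ← sub_smul, norm_smul]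
  rw [Metric.mem_ball, dist_comm, Real.dist_eq, lt_div_iff₀ hb1] at hr
  refine lt_of_le_of_lt ?_ hr
  rw [Real.norm_eq_abs]
  gcongr
  exact (hb y hy).trans ((le_abs_self b).trans (by linarith))

theorem continuous_smul_symTensors (h : SymTensors n M) : Continuous fun r : ℝ => r • h :=
  (continuous_smul_tensors h.1).subtype_mk _

/-- The product of a smooth function and a symmetric tensor field. -/
noncomputable def smulField (f : C^∞⟮𝓡 n, M; 𝓘(ℝ, ℝ), ℝ⟯) (h : SymTensors n M) : SymTensors n M :=
  ⟨⟨fun x => f x • h.1 x, f.contMDiff.smul_section h.1.contMDiff⟩, fun x v w => by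
    simp [h.2 x v w]⟩

theorem toSym_apply (g : Metrics n M) (x : M) : g.toSym.1 x = g.inner x := rfl

theorem toSym_injective : Function.Injective (Metrics.toSym : Metrics n M → SymTensors n M) := by
  intro g g' h
  have : g.inner = g'.inner := congrArg (fun s : SymTensors n M => (s.1 : ∀ x, _)) h
  cases g
  cases g'
  congr

/-- A pointwise positive definite smooth symmetric tensor field is a Riemannian metric. -/
theorem exists_toSym_eq (h : SymTensors n M)
    (hpos : ∀ (x : M) (v : TangentSpace (𝓡 n) x), v ≠ 0 → 0 < h.1 x v v) :
    ∃ g : Metrics n M, g.toSym = h :=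
  ⟨{ inner := fun x => h.1 x
     symm := h.2
     pos := hpos
     isVonNBounded := fun x => isVonNBounded_of_pos _ (hpos x)
     contMDiff := h.1.contMDiff }, rfl⟩

/-- In dimension `0` there is only one metric, because all tangent spaces vanish. -/
theorem metrics_eq_of_dim_zero (hn : n = 0) (g₀ g₁ : Metrics n M) : g₀ = g₁ := by
  subst hn
  refine toSym_injective (Subtype.ext (ContMDiffSection.ext fun x => ?_))
  exact coordMatrix_injOn (mem_chart_source _ x) (Subsingleton.elim _ _)

theorem exists_toSym_eq_scaling (g : Metrics n M) (φ : C^∞⟮𝓡 n, M; 𝓘(ℝ, ℝ), ℝ⟯)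
    (hφ : ∀ x, φ x ∈ Icc (0 : ℝ) 1) {r : ℝ} (hr0 : 0 < r) (hr1 : r ≤ 1) :
    ∃ g' : Metrics n M, g'.toSym = g.toSym + (r - 1) • smulField φ g.toSym := by
  refine exists_toSym_eq _ fun x v hv => ?_
  have h : (g.toSym + (r - 1) • smulField φ g.toSym).1 x v v =
      (1 + (r - 1) * φ x) * g.inner x v v := by
    change g.inner x v v + (r - 1) * (φ x * g.inner x v v) = _
    ring
  rw [h]
  exact mul_pos (by nlinarith [(hφ x).1, (hφ x).2]) (g.pos x v hv)

theorem exists_toSym_eq_segment (g₀ g₁ : Metrics n M) {t : ℝ} (ht : t ∈ Icc (0 : ℝ) 1) :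
    ∃ g' : Metrics n M, g'.toSym = g₀.toSym + t • (g₁.toSym - g₀.toSym) := by
  refine exists_toSym_eq _ fun x v hv => ?_
  have h : (g₀.toSym + t • (g₁.toSym - g₀.toSym)).1 x v v =
      (1 - t) * g₀.inner x v v + t * g₁.inner x v v := by
    change g₀.inner x v v + t * (g₁.inner x v v - g₀.inner x v v) = _
    ring
  rw [h]
  rcases ht.1.eq_or_lt with rfl | h0
  · simpa using g₀.pos x v hv
  · exact add_pos_of_nonneg_of_pos (mul_nonneg (sub_nonneg.2 ht.2) (g₀.pos x v hv).le)
      (mul_pos h0 (g₁.pos x v hv))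

theorem inner_eq_of_toSym_eq_scaling {g k : Metrics n M} {φ : C^∞⟮𝓡 n, M; 𝓘(ℝ, ℝ), ℝ⟯} {r : ℝ}
    (hk : k.toSym = g.toSym + r • smulField φ g.toSym) (x : M) :
    k.inner x = (1 + r * φ x) • g.inner x := by
  have : k.toSym.1 x = g.inner x + r • φ x • g.inner x := by
    rw [hk]
    rfl
  rw [← toSym_apply, this, smul_smul, add_smul, one_smul]

theorem smul_add_smul_sub_smul {V : Type*} [AddCommGroup V] [Module ℝ V] (ψ t : ℝ) (a b : V) :
    ψ • a + t • (ψ • b - ψ • a) = ψ • ((1 - t) • a + t • b) := by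
  module

theorem inner_eq_of_toSym_eq_segment {g₀ g₁ k₀ k₁ g : Metrics n M} {ψ : ℝ} {t : ℝ} {x : M}
    (h₀ : k₀.inner x = ψ • g₀.inner x) (h₁ : k₁.inner x = ψ • g₁.inner x)
    (hg : g.toSym = k₀.toSym + t • (k₁.toSym - k₀.toSym)) :
    g.inner x = ψ • ((1 - t) • g₀.inner x + t • g₁.inner x) := by
  have : g.toSym.1 x = k₀.inner x + t • (k₁.inner x - k₀.inner x) := by
    rw [hg]
    rfl
  rw [← toSym_apply, this, h₀, h₁]
  exact smul_add_smul_sub_smul ψ t _ _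

theorem sub_toSym_apply {g₀ g₁ k₀ k₁ : Metrics n M} {ψ : ℝ} {x : M}
    (h₀ : k₀.inner x = ψ • g₀.inner x) (h₁ : k₁.inner x = ψ • g₁.inner x) :
    (k₁.toSym - k₀.toSym).1 x = ψ • (g₁.inner x - g₀.inner x) := by
  change k₁.inner x - k₀.inner x = _
  rw [h₀, h₁]
  exact (smul_sub ψ (g₁.inner x : TensorFiber n M x) (g₀.inner x)).symm

theorem tendsto_affine_slope (p q : SymTensors n M) {c : ℝ → ℝ} {c' t : ℝ}
    (hc : HasDerivAt c c' t) :
    Tendsto (fun s : ℝ => (s - t)⁻¹ • ((p + c s • q) - (p + c t • q))) (𝓝[≠] t)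
      (𝓝 (c' • q)) := by
  have h1 := ((continuous_smul_symTensors q).tendsto c').comp (hasDerivAt_iff_tendsto_slope.1 hc)
  refine h1.congr fun s => ?_
  simp only [Function.comp, slope_def_field, add_sub_add_left_eq_sub, ← sub_smul, smul_smul]
  congr 1
  ring

variable [CompactSpace M] [MeasurableSpace M]

/-- If finitely many affine curves `t ↦ pᵢ + cᵢ(t) qᵢ`, `0 ≤ t ≤ 1`, of Riemannian metrics fit
together to a path and the `i`-th one has speed at most `Lᵢ`, then the distance of the end points
is at most `∑ Lᵢ`. -/
theorem l2Dist_le_sum (N : ℕ) {g₀ g₁ : Metrics n M} (p q : ℕ → SymTensors n M)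
    (c c' : ℕ → ℝ → ℝ) (L : ℕ → ℝ≥0∞)
    (hc : ∀ i t, HasDerivAt (c i) (c' i t) t) (hc' : ∀ i, Continuous (c' i))
    (hpos : ∀ i < N, ∀ t ∈ Icc (0 : ℝ) 1, ∃ g : Metrics n M, g.toSym = p i + c i t • q i)
    (hglue : ∀ i < N, p i + c i 1 • q i = p (i + 1) + c (i + 1) 0 • q (i + 1))
    (h₀ : g₀.toSym = p 0 + c 0 0 • q 0) (h₁ : g₁.toSym = p N + c N 0 • q N)
    (hL : ∀ i < N, ∀ t ∈ Icc (0 : ℝ) 1, ∀ g : Metrics n M, g.toSym = p i + c i t • q i →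
      ENNReal.ofReal (l2Norm g (c' i t • q i)) ≤ L i) :
    l2Dist g₀ g₁ ≤ ∑ i ∈ Finset.range N, L i := by
  -- on `[i, i + 1)` the path is the `i`-th curve, shifted by `i`; at `N` it is `p N + c N 0 • q N`
  let curve : ℝ → SymTensors n M := fun t => p ⌊t⌋₊ + c ⌊t⌋₊ (t - ⌊t⌋₊) • q ⌊t⌋₊
  let vel : ℝ → SymTensors n M := fun t => c' ⌊t⌋₊ (t - ⌊t⌋₊) • q ⌊t⌋₊
  have hcurve_nat : ∀ i : ℕ, curve i = p i + c i 0 • q i := fun i => by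
    simp only [curve, Nat.floor_natCast, sub_self]
  have hfloor : ∀ (i : ℕ) (t : ℝ), (i : ℝ) ≤ t → t < i + 1 → ⌊t⌋₊ = i := fun i t h h' =>
    (Nat.floor_eq_iff ((Nat.cast_nonneg i).trans h)).2 ⟨h, h'⟩
  have hcurve : ∀ i < N, ∀ t ∈ Icc (i : ℝ) (i + 1), curve t = p i + c i (t - i) • q i := by
    intro i hi t ht
    rcases ht.2.lt_or_eq with h | rfl
    · simp only [curve, hfloor i t ht.1 h]
    · have := hcurve_nat (i + 1)
      push_cast at this
      rw [this, ← hglue i hi]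
      simp
  have hex : ∀ i < N, ∀ t ∈ Icc (i : ℝ) (i + 1), ∃ g : Metrics n M, g.toSym = curve t := by
    intro i hi t ht
    rw [hcurve i hi t ht]
    exact hpos i hi _ ⟨by linarith [ht.1], by linarith [ht.2]⟩
  -- outside `[0, N]` the curve may leave the set of metrics, so the path takes the value `g₀` there
  have hγ' : ∀ t, ∃ g' : Metrics n M, (∃ g : Metrics n M, g.toSym = curve t) →
      g'.toSym = curve t := by
    intro t
    rcases em (∃ g : Metrics n M, g.toSym = curve t) with h | h
    · exact ⟨h.choose, fun _ => h.choose_spec⟩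
    · exact ⟨g₀, fun h' => absurd h' h⟩
  choose γ hγ' using hγ'
  have hγ : ∀ i < N, ∀ t ∈ Icc (i : ℝ) (i + 1), (γ t).toSym = p i + c i (t - i) • q i := by
    intro i hi t ht
    rw [hγ' t (hex i hi t ht), hcurve i hi t ht]
  have hstart : g₀.toSym = curve ((0 : ℕ) : ℝ) := by rw [hcurve_nat, h₀]
  have hend : g₁.toSym = curve (N : ℝ) := by rw [hcurve_nat, h₁]
  let Γ : PiecewiseC1Path g₀ g₁ :=
    { a := (0 : ℕ)
      b := N
      a_le_b := by simp
      toFun := γ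
      velocity := vel
      source := toSym_injective (by rw [hγ' _ ⟨g₀, hstart⟩, hstart])
      target := toSym_injective (by rw [hγ' _ ⟨g₁, hend⟩, hend])
      piecewise_C1 := by
        refine ⟨N, fun i => i, rfl, rfl, fun i hi => ⟨by simp, fun t => c' i (t - i) • q i,
          ?_, ?_, ?_⟩⟩
        · exact ((continuous_smul_symTensors (q i)).comp
            ((hc' i).comp (continuous_id.sub continuous_const))).continuousOn
        · intro t ht
          push_cast at ht ⊢
          have h1 : HasDerivAt (fun s : ℝ => c i (s - i)) (c' i (t - i)) t := by
            simpa using (hc i (t - i)).comp_sub_const t (i : ℝ)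
          refine ((tendsto_affine_slope (p i) (q i) h1).mono_left
            (nhdsWithin_mono _ fun s hs => hs.2)).congr' ?_
          filter_upwards [self_mem_nhdsWithin] with s hs
          rw [hγ i hi t ht, hγ i hi s hs.1]
        · intro t ht
          push_cast at ht
          simp only [vel, hfloor i t ht.1.le ht.2] }
  refine (iInf_le _ Γ).trans ?_
  -- on the half-open intervals the floor of `t` is constant; the end point `N` is a null set
  have hcover : Ico ((0 : ℕ) : ℝ) N ⊆ ⋃ i : Fin N, Ico (i : ℝ) (i + 1) := by
    intro t ht
    have h0 : (0 : ℝ) ≤ t := by simpa using ht.1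
    exact mem_iUnion.2 ⟨⟨⌊t⌋₊, (Nat.floor_lt h0).2 ht.2⟩, Nat.floor_le h0, Nat.lt_floor_add_one t⟩
  calc Γ.length = ∫⁻ t in Ico ((0 : ℕ) : ℝ) N, ENNReal.ofReal (l2Norm (γ t) (vel t)) :=
        setLIntegral_congr Ico_ae_eq_Icc.symm
    _ ≤ ∫⁻ t in ⋃ i : Fin N, Ico (i : ℝ) (i + 1),
          ENNReal.ofReal (l2Norm (γ t) (vel t)) := lintegral_mono_set hcover
    _ ≤ ∑ i ∈ Finset.range N, ∫⁻ t in Ico (i : ℝ) (i + 1),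
          ENNReal.ofReal (l2Norm (γ t) (vel t)) := by
        refine (lintegral_iUnion_le _ _).trans_eq ?_
        rw [tsum_fintype, Finset.sum_range]
    _ ≤ ∑ i ∈ Finset.range N, L i := by
        refine Finset.sum_le_sum fun i hi => ?_
        have hi := Finset.mem_range.1 hi
        calc ∫⁻ t in Ico (i : ℝ) (i + 1), ENNReal.ofReal (l2Norm (γ t) (vel t))
            ≤ ∫⁻ _ in Ico (i : ℝ) (i + 1), L i := by
              refine setLIntegral_mono' measurableSet_Ico fun t ht => ?_
              simp only [vel, hfloor i t ht.1 ht.2]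
              exact hL i hi (t - i) ⟨by linarith [ht.1], by linarith [ht.2]⟩ _
                (hγ i hi t ⟨ht.1, ht.2.le⟩)
          _ = L i := by simp

theorem l2Dist_self (g : Metrics n M) : l2Dist g g = 0 := by
  refine le_antisymm ?_ bot_le
  simpa using l2Dist_le_sum 0 (g₀ := g) (g₁ := g) (fun _ => g.toSym) (fun _ => 0)
    (fun _ _ => 0) (fun _ _ => 0) (fun _ => 0) (fun _ _ => hasDerivAt_const _ _)
    (fun _ => continuous_const) (by simp) (by simp) (by simp) (by simp) (by simp)

end Curves

/-! ### The Riemannian volume and the `L²` norm -/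

section VolumeEstimates

variable {n : ℕ} {M : Type*} [TopologicalSpace M] [ChartedSpace (EuclideanSpace ℝ (Fin n)) M]

theorem chartPiece_subset_chartCompact [CompactSpace M] (k : Fin (numCharts n M)) :
    chartPiece n M k ⊆ chartCompact n M k := fun _ hx => hx.1

theorem measurableSet_chartPiece [T2Space M] [CompactSpace M] [MeasurableSpace M] [BorelSpace M]
    (k : Fin (numCharts n M)) : MeasurableSet (chartPiece n M k) := by
  have hK : ∀ j, MeasurableSet (chartCompact n M j) := fun j =>
    (isCompact_chartCompact n M j).measurableSet
  have : chartPiece n M k = chartCompact n M k ∩ ⋂ j, ⋂ (_ : j < k), (chartCompact n M j)ᶜ := by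
    ext x
    simp [chartPiece]
  rw [this]
  exact (hK k).inter (MeasurableSet.iInter fun j => MeasurableSet.iInter fun _ => (hK j).compl)

theorem chartLebesgue_lt_top [T2Space M] [MeasurableSpace M] [BorelSpace M] {c : M} {K : Set M}
    (hK : IsCompact K) (hKs : K ⊆ (chartAt (EuclideanSpace ℝ (Fin n)) c).source) :
    chartLebesgue (n := n) c K < ⊤ := by
  set e := chartAt (EuclideanSpace ℝ (Fin n)) c
  have hae : AEMeasurable e.symm (volume.restrict e.target) :=
    e.continuousOn_symm.aemeasurable e.open_target.measurableSet
  rw [chartLebesgue, Measure.map_apply_of_aemeasurable hae hK.measurableSet,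
    Measure.restrict_apply₀' e.open_target.measurableSet.nullMeasurableSet]
  refine (measure_mono ?_).trans_lt
    (hK.image_of_continuousOn (e.continuousOn.mono hKs)).measure_lt_top
  rintro y ⟨hy, hyt⟩
  exact ⟨e.symm y, hy, e.right_inv hyt⟩

variable [IsManifold (𝓡 n) ∞ M]

theorem continuousOn_sqrt_det (c : M) (g : Metrics n M) :
    ContinuousOn (fun x => √(coordMatrix c (g.inner x)).det)
      (chartAt (EuclideanSpace ℝ (Fin n)) c).source :=
  Real.continuous_sqrt.comp_continuousOn
    ((continuous_id.matrix_det).comp_continuousOn (continuousOn_coordMatrix c g.toSym.1))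

variable [CompactSpace M] [MeasurableSpace M]

/-- The norm of the `L²` metric is bounded by a lower integral even if the integrand is not known
to be measurable. -/
theorem ofReal_l2Norm_le (g : Metrics n M) (h : SymTensors n M) :
    ENNReal.ofReal (l2Norm g h) ≤
      (∫⁻ x, ‖trInner g h h x‖ₑ ∂riemannianVolume g) ^ (1 / 2 : ℝ) := by
  rw [l2Norm, Real.sqrt_eq_rpow]
  rcases le_total 0 (l2Inner g h h) with h0 | h0
  · rw [← ENNReal.ofReal_rpow_of_nonneg h0 (by norm_num)]
    refine ENNReal.rpow_le_rpow ?_ (by norm_num)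
    rw [← Real.enorm_of_nonneg h0]
    exact enorm_integral_le_lintegral_enorm _
  · rw [← Real.sqrt_eq_rpow, Real.sqrt_eq_zero_of_nonpos h0]
    simp

variable [T2Space M] [BorelSpace M]

theorem aemeasurable_density (g : Metrics n M) (k : Fin (numCharts n M)) :
    AEMeasurable (fun x => ENNReal.ofReal √(coordMatrix (chartCenter n M k) (g.inner x)).det)
      ((chartLebesgue (n := n) (chartCenter n M k)).restrict (chartPiece n M k)) :=
  (((continuousOn_sqrt_det _ g).mono ((chartPiece_subset_chartCompact k).trans
    (chartCompact_subset_source n M k))).aemeasurable (measurableSet_chartPiece k)).ennreal_ofReal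

theorem riemannianVolume_univ_lt_top (g : Metrics n M) : riemannianVolume g univ < ⊤ := by
  rw [riemannianVolume, Measure.sum_apply _ MeasurableSet.univ, tsum_fintype]
  refine ENNReal.sum_lt_top.2 fun k _ => ?_
  obtain ⟨b, hb⟩ := (isCompact_chartCompact n M k).exists_bound_of_continuousOn
    ((continuousOn_sqrt_det (chartCenter n M k) g).mono (chartCompact_subset_source n M k))
  rw [withDensity_apply _ MeasurableSet.univ, Measure.restrict_univ]
  calc _ ≤ ∫⁻ _ in chartPiece n M k, ENNReal.ofReal b ∂chartLebesgue (n := n) (chartCenter n M k) :=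
        setLIntegral_mono' (measurableSet_chartPiece k) fun x hx =>
          ENNReal.ofReal_le_ofReal ((le_abs_self _).trans
            (hb x (chartPiece_subset_chartCompact k hx)))
    _ < ⊤ := by
        rw [setLIntegral_const]
        exact ENNReal.mul_lt_top ENNReal.ofReal_lt_top ((measure_mono
          (chartPiece_subset_chartCompact k)).trans_lt
            (chartLebesgue_lt_top (isCompact_chartCompact n M k)
              (chartCompact_subset_source n M k)))

/-- A pointwise comparison of the densities `√det(g_ij)` gives a comparison of integrals. -/
theorem lintegral_riemannianVolume_le (g g' : Metrics n M) {w : M → ℝ} (hw : Measurable w)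
    (hw0 : ∀ x, 0 ≤ w x)
    (h : ∀ k : Fin (numCharts n M), ∀ x ∈ chartCompact n M k,
      √(coordMatrix (chartCenter n M k) (g'.inner x)).det ≤
        w x * √(coordMatrix (chartCenter n M k) (g.inner x)).det)
    {f : M → ℝ≥0∞} (hf : Measurable f) :
    ∫⁻ x, f x ∂riemannianVolume g' ≤
      ∫⁻ x, f x * ENNReal.ofReal (w x) ∂riemannianVolume g := by
  have hle : riemannianVolume g' ≤
      (riemannianVolume g).withDensity (fun x => ENNReal.ofReal (w x)) := by
    rw [riemannianVolume, riemannianVolume, withDensity_sum]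
    refine Measure.le_iff.2 fun s hs => ?_
    rw [Measure.sum_apply _ hs, Measure.sum_apply _ hs]
    refine ENNReal.tsum_le_tsum fun k => ?_
    revert s
    rw [← Measure.le_iff]
    rw [← withDensity_mul₀ (aemeasurable_density g k) hw.ennreal_ofReal.aemeasurable]
    refine withDensity_mono ?_
    filter_upwards [ae_restrict_mem (measurableSet_chartPiece k)] with x hx
    rw [Pi.mul_apply, mul_comm, ← ENNReal.ofReal_mul (hw0 x)]
    exact ENNReal.ofReal_le_ofReal (h k x (chartPiece_subset_chartCompact k hx))
  refine (lintegral_mono' hle le_rfl).trans_eq ?_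
  rw [lintegral_withDensity_eq_lintegral_mul _ hw.ennreal_ofReal hf]
  simp only [Pi.mul_apply, mul_comm]

end VolumeEstimates

/-! ### The trace in different charts -/

section Trace

variable {n : ℕ}

/-- The trace `tr(A⁻¹ H A⁻¹ K)` is invariant under congruence. -/
theorem trace_inv_mul_congr (A H K P : Matrix (Fin n) (Fin n) ℝ) (hP : IsUnit P.det) :
    ((P.transpose * A * P)⁻¹ * (P.transpose * H * P) * (P.transpose * A * P)⁻¹ *
      (P.transpose * K * P)).trace = (A⁻¹ * H * A⁻¹ * K).trace := by
  have hPt : IsUnit P.transpose.det := by rwa [Matrix.det_transpose]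
  have e : (P.transpose * A * P)⁻¹ * (P.transpose * H * P) * (P.transpose * A * P)⁻¹ *
      (P.transpose * K * P) = P⁻¹ * (A⁻¹ * H * A⁻¹ * K * P) := by
    simp only [Matrix.mul_inv_rev, Matrix.mul_assoc]
    simp only [Matrix.nonsing_inv_mul_cancel_left _ _ hPt,
      Matrix.mul_nonsing_inv_cancel_left _ _ hP]
  rw [e, Matrix.trace_mul_comm, Matrix.mul_assoc, Matrix.mul_nonsing_inv _ hP, Matrix.mul_one]

variable {M : Type*} [TopologicalSpace M] [ChartedSpace (EuclideanSpace ℝ (Fin n)) M]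
  [IsManifold (𝓡 n) ∞ M]

theorem trInner_eq_of_mem_source {c x : M}
    (hx : x ∈ (chartAt (EuclideanSpace ℝ (Fin n)) c).source) (g : Metrics n M)
    (h k : SymTensors n M) :
    trInner g h k x = ((coordMatrix c (g.inner x))⁻¹ * coordMatrix c (h.1 x) *
      (coordMatrix c (g.inner x))⁻¹ * coordMatrix c (k.1 x)).trace := by
  obtain ⟨P, hP, hB⟩ := exists_coordMatrix_eq_congr hx (mem_chart_source _ x)
  rw [trInner, hB, hB, hB]
  exact trace_inv_mul_congr _ _ _ _ hP

theorem isOpen_ne_inner (g₀ g₁ : Metrics n M) : IsOpen {x | g₀.inner x ≠ g₁.inner x} := by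
  refine isOpen_iff_mem_nhds.2 fun x hx => ?_
  set s := (chartAt (EuclideanSpace ℝ (Fin n)) x).source
  have hs : s ∈ 𝓝 x :=
    (chartAt (EuclideanSpace ℝ (Fin n)) x).open_source.mem_nhds (mem_chart_source _ x)
  have h0 := (continuousOn_coordMatrix x g₀.toSym.1).continuousAt hs
  have h1 := (continuousOn_coordMatrix x g₁.toSym.1).continuousAt hs
  have hne : coordMatrix x (g₀.toSym.1 x) ≠ coordMatrix x (g₁.toSym.1 x) := fun h =>
    hx (coordMatrix_injOn (mem_chart_source _ x) h)
  filter_upwards [(h0.sub h1).eventually_ne (sub_ne_zero.2 hne)] with y hy h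
  exact hy (sub_eq_zero.2 (congrArg (coordMatrix x) h))

end Trace

/-! ### The speed of the curves -/

section Speed

variable {n : ℕ}

theorem sqrt_pow_le_sqrt (hn : n ≠ 0) {r : ℝ} (h0 : 0 ≤ r) (h1 : r ≤ 1) : √(r ^ n) ≤ √r :=
  Real.sqrt_le_sqrt (pow_le_of_le_one h0 h1 hn)

/-- The speed density of the scaling curve. With `ψ = 1 + (τ⁴ - 1)φ ≥ τ⁴`, the estimate rests on
`√(ψⁿ) ≤ √ψ` and `τ² ≤ √ψ`, so that `(φr/ψ)²√ψ ≤ 16 τ⁶ / √ψ³ ≤ 16`. -/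
theorem scaling_density_le (hn : n ≠ 0) {φ τ r : ℝ} (hφ0 : 0 ≤ φ) (hφ1 : φ ≤ 1) (hτ0 : 0 < τ)
    (hτ1 : τ ≤ 1) (hr : |r| ≤ 4 * τ ^ 3) :
    (r * φ / (1 + (τ ^ 4 - 1) * φ)) ^ 2 * √((1 + (τ ^ 4 - 1) * φ) ^ n) ≤ 16 := by
  set ψ := 1 + (τ ^ 4 - 1) * φ with hψ
  have hτ4 : τ ^ 4 ≤ 1 := pow_le_one₀ hτ0.le hτ1
  have hτψ : τ ^ 4 ≤ ψ := by nlinarith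
  have hψ0 : 0 < ψ := (pow_pos hτ0 4).trans_le hτψ
  have hψ1 : ψ ≤ 1 := by nlinarith
  set σ := √ψ with hσ
  have hσ0 : 0 < σ := Real.sqrt_pos.2 hψ0
  have hσψ : σ ^ 2 = ψ := Real.sq_sqrt hψ0.le
  have hτσ : τ ^ 2 ≤ σ := Real.le_sqrt_of_sq_le (by rw [← pow_mul]; exact hτψ)
  have hrφ : (r * φ) ^ 2 ≤ (4 * τ ^ 3) ^ 2 := by
    refine sq_le_sq' ?_ ?_
    · nlinarith [(abs_le.1 hr).1, pow_pos hτ0 3]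
    · nlinarith [(abs_le.1 hr).2, pow_pos hτ0 3]
  calc (r * φ / ψ) ^ 2 * √(ψ ^ n) ≤ (r * φ / ψ) ^ 2 * σ := by
        gcongr
        exact sqrt_pow_le_sqrt hn hψ0.le hψ1
    _ = (r * φ) ^ 2 / σ ^ 3 := by
        rw [← hσψ]
        field_simp
    _ ≤ (4 * τ ^ 3) ^ 2 / σ ^ 3 := by gcongr
    _ ≤ 16 := by
        rw [div_le_iff₀ (by positivity)]
        have := pow_le_pow_left₀ (by positivity) hτσ 3
        nlinarith

variable {M : Type*} [TopologicalSpace M] [ChartedSpace (EuclideanSpace ℝ (Fin n)) M]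
  [IsManifold (𝓡 n) ∞ M]

/-- For conformal variations, the trace is explicit. -/
theorem trInner_of_conformal (g g' : Metrics n M) (h : SymTensors n M) (x : M) {ψ ρ : ℝ}
    (hψ : ψ ≠ 0) (hg' : g'.inner x = ψ • g.inner x) (hh : h.1 x = ρ • g.inner x) :
    trInner g' h h x = n * (ρ / ψ) ^ 2 := by
  have hA : IsUnit (coordMatrix x (g.inner x)).det :=
    (det_coordMatrix_pos (mem_chart_source _ x) g).ne'.isUnit
  have hinv : (ψ • coordMatrix x (g.inner x))⁻¹ = ψ⁻¹ • (coordMatrix x (g.inner x))⁻¹ :=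
    Matrix.inv_smul' _ (Units.mk0 ψ hψ) hA
  rw [trInner, hg', hh, coordMatrix_smul, coordMatrix_smul, hinv]
  simp only [Matrix.smul_mul, Matrix.mul_smul, Matrix.nonsing_inv_mul _ hA, Matrix.one_mul,
    Matrix.trace_smul, Matrix.trace_one, Fintype.card_fin, smul_eq_mul]
  field_simp

/-- On the segment between two metrics, the traces of the squared difference and the volume
densities are uniformly bounded. -/
theorem exists_segment_bound [CompactSpace M] (g₀ g₁ : Metrics n M) :
    ∃ B : ℝ, 0 ≤ B ∧ ∀ k : Fin (numCharts n M), ∀ x ∈ chartCompact n M k, ∀ t ∈ Icc (0 : ℝ) 1,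
      ∀ A D : Matrix (Fin n) (Fin n) ℝ,
      A = (1 - t) • coordMatrix (chartCenter n M k) (g₀.inner x) +
        t • coordMatrix (chartCenter n M k) (g₁.inner x) →
      D = coordMatrix (chartCenter n M k) (g₁.inner x) -
        coordMatrix (chartCenter n M k) (g₀.inner x) →
      |(A⁻¹ * D * A⁻¹ * D).trace| ≤ B ∧
      √A.det ≤ B * √(coordMatrix (chartCenter n M k) (g₀.inner x)).det := by
  have key : ∀ k : Fin (numCharts n M), ∃ B : ℝ, ∀ x ∈ chartCompact n M k, ∀ t ∈ Icc (0 : ℝ) 1,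
      ∀ A D : Matrix (Fin n) (Fin n) ℝ,
      A = (1 - t) • coordMatrix (chartCenter n M k) (g₀.inner x) +
        t • coordMatrix (chartCenter n M k) (g₁.inner x) →
      D = coordMatrix (chartCenter n M k) (g₁.inner x) -
        coordMatrix (chartCenter n M k) (g₀.inner x) →
      |(A⁻¹ * D * A⁻¹ * D).trace| ≤ B ∧
      √A.det ≤ B * √(coordMatrix (chartCenter n M k) (g₀.inner x)).det := by
    intro k
    set c := chartCenter n M k
    set S := Icc (0 : ℝ) 1 ×ˢ chartCompact n M k
    have hS : IsCompact S := isCompact_Icc.prod (isCompact_chartCompact n M k)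
    have hsrc := chartCompact_subset_source n M k
    have hsnd : ∀ g : Metrics n M,
        ContinuousOn (fun p : ℝ × M => coordMatrix c (g.inner p.2)) S := fun g =>
      (continuousOn_coordMatrix c g.toSym.1).comp continuousOn_snd fun p hp => hsrc hp.2
    let A : ℝ × M → Matrix (Fin n) (Fin n) ℝ := fun p =>
      (1 - p.1) • coordMatrix c (g₀.inner p.2) + p.1 • coordMatrix c (g₁.inner p.2)
    let D : ℝ × M → Matrix (Fin n) (Fin n) ℝ := fun p =>
      coordMatrix c (g₁.inner p.2) - coordMatrix c (g₀.inner p.2)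
    have hA : ContinuousOn A S :=
      ((continuousOn_const.sub continuousOn_fst).smul (hsnd g₀)).add
        (continuousOn_fst.smul (hsnd g₁))
    have hD : ContinuousOn D S := (hsnd g₁).sub (hsnd g₀)
    have hApos : ∀ p ∈ S, (A p).det ≠ 0 := fun p hp => by
      have h0 := coordMatrix_posDef (hsrc hp.2) g₀
      have h1 := coordMatrix_posDef (hsrc hp.2) g₁
      have ht := hp.1
      rcases ht.1.eq_or_lt with h | h
      · simpa [A, ← h] using h0.det_pos.ne'
      · exact (Matrix.PosDef.posSemidef_add (h0.posSemidef.smul (sub_nonneg.2 ht.2))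
          (h1.smul h)).det_pos.ne'
    -- all quantities are continuous in `(t, x)` on the compact set `S`, since `A` is invertible
    have hdet : ContinuousOn (fun p => (A p).det) S := continuous_id.matrix_det.comp_continuousOn hA
    have hinv : ContinuousOn (fun p => (A p)⁻¹) S := by
      simp only [Matrix.inv_def, Ring.inverse_eq_inv']
      exact (hdet.inv₀ hApos).smul (continuous_id.matrix_adjugate.comp_continuousOn hA)
    have htr : ContinuousOn (fun p => ((A p)⁻¹ * D p * (A p)⁻¹ * D p).trace) S :=
      continuous_id.matrix_trace.comp_continuousOn (((hinv.mul hD).mul hinv).mul hD)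
    have hg₀pos : ∀ p ∈ S, 0 < √(coordMatrix c (g₀.inner p.2)).det := fun p hp =>
      Real.sqrt_pos.2 (det_coordMatrix_pos (hsrc hp.2) g₀)
    have hq : ContinuousOn (fun p => √(A p).det / √(coordMatrix c (g₀.inner p.2)).det) S :=
      (Real.continuous_sqrt.comp_continuousOn hdet).div
        ((continuousOn_sqrt_det c g₀).comp continuousOn_snd fun p hp => hsrc hp.2)
        fun p hp => (hg₀pos p hp).ne'
    obtain ⟨b₁, hb₁⟩ := hS.exists_bound_of_continuousOn htr
    obtain ⟨b₂, hb₂⟩ := hS.exists_bound_of_continuousOn hq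
    refine ⟨max b₁ b₂, ?_⟩
    rintro x hx t ht _ _ rfl rfl
    have hp : (t, x) ∈ S := ⟨ht, hx⟩
    refine ⟨(hb₁ _ hp).trans (le_max_left _ _), ?_⟩
    rw [← div_le_iff₀ (hg₀pos _ hp)]
    exact (le_abs_self _).trans ((hb₂ _ hp).trans (le_max_right _ _))
  choose B hB using key
  obtain ⟨b, hb⟩ := (Set.finite_range B).bddAbove
  refine ⟨max b 0, le_max_right _ _, fun k x hx t ht A D hA hD => ?_⟩
  have hk : B k ≤ max b 0 := (hb (mem_range_self k)).trans (le_max_left _ _)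
  obtain ⟨h1, h2⟩ := hB k x hx t ht A D hA hD
  exact ⟨h1.trans hk, h2.trans (by gcongr)⟩

variable [T2Space M] [CompactSpace M] [MeasurableSpace M] [BorelSpace M]

/-- The curves `τ ↦ (1 + (τ⁴ - 1)φ) g`, which scale a metric down on a set `E`, have bounded
speed in terms of the volume of `E`. -/
theorem ofReal_l2Norm_scaling_le (hn : n ≠ 0) (g g' : Metrics n M)
    (φ : C^∞⟮𝓡 n, M; 𝓘(ℝ, ℝ), ℝ⟯) (hφ : ∀ x, φ x ∈ Icc (0 : ℝ) 1) {E : Set M}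
    (hE : MeasurableSet E) (hφE : ∀ x ∉ E, φ x = 0) {τ r : ℝ} (hτ0 : 0 < τ) (hτ1 : τ ≤ 1)
    (hr : |r| ≤ 4 * τ ^ 3)
    (hg' : g'.toSym = g.toSym + (τ ^ 4 - 1) • smulField φ g.toSym) :
    ENNReal.ofReal (l2Norm g' (r • smulField φ g.toSym)) ≤
      ((4 * NNReal.sqrt n : ℝ≥0) : ℝ≥0∞) * riemannianVolume g E ^ (1 / 2 : ℝ) := by
  set ψ : M → ℝ := fun x => 1 + (τ ^ 4 - 1) * φ x with hψ
  have hψ0 : ∀ x, 0 < ψ x := fun x => by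
    have h4 : τ ^ 4 ≤ 1 := pow_le_one₀ hτ0.le hτ1
    have := pow_pos hτ0 4
    simp only [hψ]
    nlinarith [(hφ x).1, (hφ x).2]
  have hφm : Measurable φ := φ.contMDiff.continuous.measurable
  have hψm : Measurable ψ := by fun_prop
  have hg'x : ∀ x, g'.inner x = ψ x • g.inner x := inner_eq_of_toSym_eq_scaling hg'
  have htr : ∀ x, trInner g' (r • smulField φ g.toSym) (r • smulField φ g.toSym) x =
      n * (r * φ x / ψ x) ^ 2 := fun x =>
    trInner_of_conformal g g' _ x (hψ0 x).ne' (hg'x x) (by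
      rw [← smul_smul]
      rfl)
  have hdet : ∀ (c x : M), √(coordMatrix c (g'.inner x)).det =
      √(ψ x ^ n) * √(coordMatrix c (g.inner x)).det := fun c x => by
    rw [hg'x, coordMatrix_smul, Matrix.det_smul, Fintype.card_fin,
      Real.sqrt_mul (pow_nonneg (hψ0 x).le n)]
  have hint : ∫⁻ x, ‖trInner g' (r • smulField φ g.toSym) (r • smulField φ g.toSym) x‖ₑ
      ∂riemannianVolume g' ≤ ENNReal.ofReal (16 * n) * riemannianVolume g E := by
    simp only [htr]
    refine (lintegral_riemannianVolume_le g g' (w := fun x => √(ψ x ^ n)) (by fun_prop)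
      (fun x => Real.sqrt_nonneg _) (fun k x _ => (hdet _ x).le)
      (f := fun x => ‖n * (r * φ x / ψ x) ^ 2‖ₑ) (by fun_prop)).trans ?_
    rw [← lintegral_indicator_const hE]
    refine lintegral_mono fun x => ?_
    by_cases hx : x ∈ E
    · rw [indicator_of_mem hx, Real.enorm_of_nonneg (by positivity),
        ← ENNReal.ofReal_mul (by positivity)]
      refine ENNReal.ofReal_le_ofReal ?_
      have := scaling_density_le hn (hφ x).1 (hφ x).2 hτ0 hτ1 hr
      rw [mul_assoc, mul_comm (16 : ℝ)]
      gcongr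
    · simp [hφE x hx]
  refine (ofReal_l2Norm_le g' _).trans
    ((ENNReal.rpow_le_rpow hint (by norm_num)).trans_eq ?_)
  rw [ENNReal.mul_rpow_of_nonneg _ _ (by norm_num)]
  congr 1
  rw [ENNReal.ofReal_rpow_of_nonneg (by positivity) (by norm_num), ← Real.sqrt_eq_rpow,
    Real.sqrt_mul (by norm_num), show (16 : ℝ) = 4 ^ 2 by norm_num, Real.sqrt_sq (by norm_num),
    ENNReal.ofReal, Real.toNNReal_mul (by norm_num), Real.toNNReal_ofNat]
  congr 2
  ext
  simp

/-- The squared speed of the segment between `ψ g₀` and `ψ g₁` is controlled by the integral of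
`√ψ` over the set where the two metrics differ. -/
theorem exists_lintegral_trInner_segment_le (hn : n ≠ 0) (g₀ g₁ : Metrics n M) :
    ∃ B : ℝ≥0, ∀ (ψ : M → ℝ) (t : ℝ) (g' : Metrics n M) (h : SymTensors n M),
      Measurable ψ → (∀ x, 0 < ψ x) → (∀ x, ψ x ≤ 1) → t ∈ Icc (0 : ℝ) 1 →
      (∀ x, g'.inner x = ψ x • ((1 - t) • g₀.inner x + t • g₁.inner x)) →
      (∀ x, h.1 x = ψ x • (g₁.inner x - g₀.inner x)) →
      ∫⁻ x, ‖trInner g' h h x‖ₑ ∂riemannianVolume g' ≤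
        B * ∫⁻ x in {x | g₀.inner x ≠ g₁.inner x}, ENNReal.ofReal √(ψ x)
          ∂riemannianVolume g₀ := by
  obtain ⟨B, hB0, hB⟩ := exists_segment_bound g₀ g₁
  -- one factor `B` bounds the trace, the other one the volume density
  refine ⟨(B * B).toNNReal, fun ψ t g' h hψm hψ0 hψ1 ht hg' hh => ?_⟩
  set E := {x | g₀.inner x ≠ g₁.inner x}
  have hE : MeasurableSet E := (isOpen_ne_inner g₀ g₁).measurableSet
  have hmat : ∀ c x : M, coordMatrix c (g'.inner x) =
      ψ x • ((1 - t) • coordMatrix c (g₀.inner x) + t • coordMatrix c (g₁.inner x)) :=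
    fun c x => by
      rw [hg', coordMatrix_smul, coordMatrix_add, coordMatrix_smul, coordMatrix_smul]
  have htr : ∀ x, ‖trInner g' h h x‖ₑ ≤ E.indicator (fun _ => ENNReal.ofReal B) x := by
    intro x
    by_cases hx : x ∈ E
    · rw [indicator_of_mem hx, ← ofReal_norm, Real.norm_eq_abs]
      refine ENNReal.ofReal_le_ofReal ?_
      obtain ⟨k, hk⟩ := chartCompact_cover n M x
      have hxs := chartCompact_subset_source n M k hk
      rw [trInner_eq_of_mem_source hxs, hmat, hh, coordMatrix_smul, coordMatrix_sub]
      set A := (1 - t) • coordMatrix (chartCenter n M k) (g₀.inner x) +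
        t • coordMatrix (chartCenter n M k) (g₁.inner x) with hA
      have hAu : IsUnit A.det := by
        have h1 := det_coordMatrix_pos hxs g'
        rw [hmat, ← hA, Matrix.det_smul] at h1
        exact (right_ne_zero_of_mul h1.ne').isUnit
      have hinv : (ψ x • A)⁻¹ = (ψ x)⁻¹ • A⁻¹ :=
        Matrix.inv_smul' _ (Units.mk0 (ψ x) (hψ0 x).ne') hAu
      rw [hinv]
      simp only [Matrix.smul_mul, Matrix.mul_smul, smul_smul]
      rw [show ψ x * ((ψ x)⁻¹ * (ψ x * (ψ x)⁻¹)) = 1 by field_simp [(hψ0 x).ne'], one_smul]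
      exact (hB k x hk t ht _ _ hA rfl).1
    · have : g₀.inner x = g₁.inner x := not_not.1 hx
      have h0 : coordMatrix x (h.1 x) = 0 := by
        rw [hh, coordMatrix_smul, coordMatrix_sub, this, sub_self, smul_zero]
      simp [trInner, h0]
  calc ∫⁻ x, ‖trInner g' h h x‖ₑ ∂riemannianVolume g'
      ≤ ∫⁻ x, E.indicator (fun _ => ENNReal.ofReal B) x ∂riemannianVolume g' := lintegral_mono htr
    _ ≤ ∫⁻ x, E.indicator (fun _ => ENNReal.ofReal B) x * ENNReal.ofReal (B * √(ψ x))
          ∂riemannianVolume g₀ := by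
        refine lintegral_riemannianVolume_le g₀ g' (by fun_prop) (fun x => by positivity) ?_
          (measurable_const.indicator hE)
        intro k x hx
        rw [hmat, Matrix.det_smul, Fintype.card_fin, Real.sqrt_mul (pow_nonneg (hψ0 x).le n),
          mul_comm B, mul_assoc]
        exact mul_le_mul (sqrt_pow_le_sqrt hn (hψ0 x).le (hψ1 x)) (hB k x hx t ht _ _ rfl rfl).2
          (Real.sqrt_nonneg _) (Real.sqrt_nonneg _)
    _ = ∫⁻ x in E, ENNReal.ofReal (B * B) * ENNReal.ofReal √(ψ x) ∂riemannianVolume g₀ := by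
        rw [← lintegral_indicator hE]
        refine lintegral_congr fun x => ?_
        by_cases hx : x ∈ E
        · rw [indicator_of_mem hx, indicator_of_mem hx, ENNReal.ofReal_mul hB0,
            ENNReal.ofReal_mul hB0, mul_assoc]
        · rw [indicator_of_notMem hx, indicator_of_notMem hx, zero_mul]
    _ = _ := lintegral_const_mul _ (by fun_prop)

end Speed

/-! ### The distance estimate -/

section Main

/-- The integral of the square root of the conformal factor `1 + (s⁴ - 1)φ`, when `φ = 1` on `K`
and `s` is small. -/
theorem setLIntegral_sqrt_factor_le {X : Type*} [MeasurableSpace X] (μ : Measure X)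
    {E K : Set X} (hE : MeasurableSet E)
    (hK : MeasurableSet K) {φ : X → ℝ} (hφ : ∀ x, φ x ∈ Icc (0 : ℝ) 1)
    (hφK : ∀ x ∈ K, φ x = 1) {s : ℝ} (hs0 : 0 < s) (hs1 : s ≤ 1) :
    ∫⁻ x in E, ENNReal.ofReal √(1 + (s ^ 4 - 1) * φ x) ∂μ ≤
      ENNReal.ofReal (s ^ 2) * μ univ + μ (E \ K) := by
  have h4 : s ^ 4 ≤ 1 := pow_le_one₀ hs0.le hs1
  rw [← lintegral_inter_add_sdiff _ E hK]
  gcongr ?_ + ?_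
  · calc ∫⁻ x in E ∩ K, ENNReal.ofReal √(1 + (s ^ 4 - 1) * φ x) ∂μ
        ≤ ∫⁻ _ in E ∩ K, ENNReal.ofReal (s ^ 2) ∂μ := by
          refine setLIntegral_mono' (hE.inter hK) fun x hx => ENNReal.ofReal_le_ofReal ?_
          rw [hφK x hx.2, show 1 + (s ^ 4 - 1) * 1 = (s ^ 2) ^ 2 by ring,
            Real.sqrt_sq (by positivity)]
      _ ≤ _ := by
          rw [setLIntegral_const]
          gcongr
          exact subset_univ _
  · calc ∫⁻ x in E \ K, ENNReal.ofReal √(1 + (s ^ 4 - 1) * φ x) ∂μ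
        ≤ ∫⁻ _ in E \ K, 1 ∂μ := by
          refine setLIntegral_mono' (hE.diff hK) fun x hx => ?_
          rw [ENNReal.ofReal_le_one, Real.sqrt_le_iff]
          refine ⟨zero_le_one, ?_⟩
          nlinarith [(hφ x).1]
      _ = _ := setLIntegral_one _

variable {n : ℕ} {M : Type*} [TopologicalSpace M] [ChartedSpace (EuclideanSpace ℝ (Fin n)) M]
  [IsManifold (𝓡 n) ∞ M] [T2Space M] [CompactSpace M] [MeasurableSpace M] [BorelSpace M]

/-- For every open set `E` there is a smooth cutoff function, supported in `E`, that equals `1`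
on `E` up to a set of small volume. -/
theorem exists_cutoff (g : Metrics n M) {E : Set M} (hE : IsOpen E) {η : ℝ≥0∞} (hη : η ≠ 0) :
    ∃ (φ : C^∞⟮𝓡 n, M; 𝓘(ℝ, ℝ), ℝ⟯) (K : Set M), IsClosed K ∧ (∀ x, φ x ∈ Icc (0 : ℝ) 1) ∧
      (∀ x ∉ E, φ x = 0) ∧ (∀ x ∈ K, φ x = 1) ∧ riemannianVolume g (E \ K) < η := by
  have : TopologicalSpace.MetrizableSpace M := Manifold.metrizableSpace (𝓡 n) M
  have : IsFiniteMeasure (riemannianVolume g) := ⟨riemannianVolume_univ_lt_top g⟩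
  obtain ⟨K, hKE, hK, hμ⟩ :=
    hE.measurableSet.exists_isClosed_sdiff_lt (measure_ne_top (riemannianVolume g) E) hη
  obtain ⟨φ, h0, h1, h01⟩ := exists_contMDiffMap_zero_one_of_isClosed (n := (⊤ : ℕ∞)) (𝓡 n)
    hE.isClosed_compl hK (disjoint_compl_left.mono_right hKE)
  exact ⟨φ, K, hK, h01, fun x hx => h0 hx, fun x hx => h1 hx, hμ⟩

/-- The distance is at most the sum of the lengths of three curves: `g₀` is scaled down to `ψ g₀`,
which is joined by a segment to `ψ g₁`, and `ψ g₁` is scaled up to `g₁`. -/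
theorem l2Dist_le_of_cutoff (hn : n ≠ 0) (g₀ g₁ : Metrics n M)
    (φ : C^∞⟮𝓡 n, M; 𝓘(ℝ, ℝ), ℝ⟯) (hφ : ∀ x, φ x ∈ Icc (0 : ℝ) 1) {E : Set M}
    (hE : MeasurableSet E) (hφE : ∀ x ∉ E, φ x = 0) {s : ℝ} (hs0 : 0 < s) (hs1 : s ≤ 1)
    (L : ℝ≥0∞)
    (hL : ∀ t ∈ Icc (0 : ℝ) 1, ∀ (g' : Metrics n M) (h : SymTensors n M),
      (∀ x, g'.inner x = (1 + (s ^ 4 - 1) * φ x) • ((1 - t) • g₀.inner x + t • g₁.inner x)) →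
      (∀ x, h.1 x = (1 + (s ^ 4 - 1) * φ x) • (g₁.inner x - g₀.inner x)) →
      ENNReal.ofReal (l2Norm g' h) ≤ L) :
    l2Dist g₀ g₁ ≤
      ((4 * NNReal.sqrt n : ℝ≥0) : ℝ≥0∞) *
        (riemannianVolume g₀ E ^ (1 / 2 : ℝ) + riemannianVolume g₁ E ^ (1 / 2 : ℝ)) + L := by
  have h4 : s ^ 4 ≤ 1 := pow_le_one₀ hs0.le hs1
  have h40 : 0 < s ^ 4 := pow_pos hs0 4
  -- the scaling parameter runs from `1` to `s` on the first curve, and backwards on the third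
  have hτ : ∀ t ∈ Icc (0 : ℝ) 1, (0 < 1 + (s - 1) * t ∧ 1 + (s - 1) * t ≤ 1) ∧
      0 < s + (1 - s) * t ∧ s + (1 - s) * t ≤ 1 := fun t ht =>
    ⟨⟨by nlinarith [ht.1, ht.2], by nlinarith [ht.1, ht.2]⟩,
      by nlinarith [ht.1, ht.2], by nlinarith [ht.1, ht.2]⟩
  have hd : ∀ α β t : ℝ, HasDerivAt (fun t => (α + β * t) ^ 4 - 1)
      (4 * (α + β * t) ^ 3 * β) t := fun α β t => by
    have h1 : HasDerivAt (fun t => α + β * t) β t := by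
      simpa using ((hasDerivAt_id t).const_mul β).const_add α
    simpa using (h1.pow 4).sub_const 1
  have habs : ∀ {τ β : ℝ}, 0 < τ → |β| ≤ 1 → |4 * τ ^ 3 * β| ≤ 4 * τ ^ 3 := fun h hβ => by
    rw [abs_mul, abs_of_pos (by positivity)]
    exact mul_le_of_le_one_right (by positivity) hβ
  -- `k₀ = ψ g₀` and `k₁ = ψ g₁`
  obtain ⟨k₀, hk₀⟩ := exists_toSym_eq_scaling g₀ φ hφ h40 h4
  obtain ⟨k₁, hk₁⟩ := exists_toSym_eq_scaling g₁ φ hφ h40 h4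
  let V : Metrics n M → ℝ≥0∞ := fun g =>
    ((4 * NNReal.sqrt n : ℝ≥0) : ℝ≥0∞) * riemannianVolume g E ^ (1 / 2 : ℝ)
  let p : ℕ → SymTensors n M
    | 0 => g₀.toSym
    | 1 => k₀.toSym
    | _ => g₁.toSym
  let q : ℕ → SymTensors n M
    | 0 => smulField φ g₀.toSym
    | 1 => k₁.toSym - k₀.toSym
    | 2 => smulField φ g₁.toSym
    | _ => 0
  let c : ℕ → ℝ → ℝ
    | 0 => fun t => (1 + (s - 1) * t) ^ 4 - 1
    | 1 => fun t => t
    | _ => fun t => (s + (1 - s) * t) ^ 4 - 1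
  let c' : ℕ → ℝ → ℝ
    | 0 => fun t => 4 * (1 + (s - 1) * t) ^ 3 * (s - 1)
    | 1 => fun _ => 1
    | _ => fun t => 4 * (s + (1 - s) * t) ^ 3 * (1 - s)
  let Λ : ℕ → ℝ≥0∞
    | 0 => V g₀
    | 1 => L
    | _ => V g₁
  have hsum : l2Dist g₀ g₁ ≤ ∑ i ∈ Finset.range 3, Λ i := by
    refine l2Dist_le_sum 3 p q c c' Λ ?_ ?_ ?_ ?_ ?_ ?_ ?_
    · rintro (_ | _ | i) t
      · exact hd _ _ t
      · exact hasDerivAt_id t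
      · exact hd _ _ t
    · rintro (_ | _ | i)
      · change Continuous fun t => 4 * (1 + (s - 1) * t) ^ 3 * (s - 1)
        fun_prop
      · exact continuous_const
      · change Continuous fun t => 4 * (s + (1 - s) * t) ^ 3 * (1 - s)
        fun_prop
    · rintro (_ | _ | _ | i) hi t ht
      · exact exists_toSym_eq_scaling g₀ φ hφ (pow_pos (hτ t ht).1.1 4)
          (pow_le_one₀ (hτ t ht).1.1.le (hτ t ht).1.2)
      · exact exists_toSym_eq_segment k₀ k₁ ht
      · exact exists_toSym_eq_scaling g₁ φ hφ (pow_pos (hτ t ht).2.1 4)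
          (pow_le_one₀ (hτ t ht).2.1.le (hτ t ht).2.2)
      · omega
    · rintro (_ | _ | _ | i) hi
      · simp [p, q, c, hk₀]
      · simp [p, q, c, hk₁]
      · simp [p, q, c]
      · omega
    · simp [p, q, c]
    · simp [p, q, c]
    · rintro (_ | _ | _ | i) hi t ht g hg
      · refine ofReal_l2Norm_scaling_le hn g₀ g φ hφ hE hφE (hτ t ht).1.1 (hτ t ht).1.2
          (habs (hτ t ht).1.1 ?_) hg
        rw [abs_le]
        constructor <;> linarith
      · refine hL t ht g _ (fun x => inner_eq_of_toSym_eq_segment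
          (inner_eq_of_toSym_eq_scaling hk₀ x) (inner_eq_of_toSym_eq_scaling hk₁ x) hg) fun x => ?_
        have e : c' (0 + 1) t • q (0 + 1) = k₁.toSym - k₀.toSym := one_smul _ _
        rw [e]
        exact sub_toSym_apply (inner_eq_of_toSym_eq_scaling hk₀ x)
          (inner_eq_of_toSym_eq_scaling hk₁ x)
      · refine ofReal_l2Norm_scaling_le hn g₁ g φ hφ hE hφE (hτ t ht).2.1 (hτ t ht).2.2
          (habs (hτ t ht).2.1 ?_) hg
        rw [abs_le]
        constructor <;> linarith
      · omega
  refine hsum.trans_eq ?_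
  simp only [Finset.sum_range_succ, Finset.sum_range_zero, Λ, V, mul_add]
  ring

theorem l2Dist_le_volume (g₀ g₁ : Metrics n M) :
    l2Dist g₀ g₁ ≤
      ((4 * NNReal.sqrt n : ℝ≥0) : ℝ≥0∞) *
        (riemannianVolume g₀ {x | g₀.inner x ≠ g₁.inner x} ^ (1 / 2 : ℝ) +
          riemannianVolume g₁ {x | g₀.inner x ≠ g₁.inner x} ^ (1 / 2 : ℝ)) := by
  rcases eq_or_ne n 0 with hn | hn
  · rw [metrics_eq_of_dim_zero hn g₀ g₁, l2Dist_self]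
    exact zero_le
  set E := {x | g₀.inner x ≠ g₁.inner x}
  have hEo : IsOpen E := isOpen_ne_inner g₀ g₁
  obtain ⟨B, hB⟩ := exists_lintegral_trInner_segment_le hn g₀ g₁
  refine ENNReal.le_of_forall_pos_le_add fun ε hε _ => ?_
  -- `η` is chosen such that `B * (η + η) ≤ ε ^ 2`
  set η : ℝ≥0 := ε ^ 2 / (2 * (B + 1)) with hη
  have hη0 : 0 < η := by positivity
  obtain ⟨φ, K, hK, hφ, hφE, hφK, hEK⟩ := exists_cutoff g₀ hEo
    (ENNReal.coe_ne_zero.2 hη0.ne')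
  set m : ℝ := (riemannianVolume g₀ univ).toReal
  have hm0 : 0 ≤ m := ENNReal.toReal_nonneg
  obtain ⟨s, hs0, hs1, hsm⟩ : ∃ s : ℝ, 0 < s ∧ s ≤ 1 ∧ s ^ 2 * m ≤ η := by
    have hη0' : (0 : ℝ) < η := hη0
    refine ⟨min 1 (η / (m + 1)), by positivity, min_le_left _ _, ?_⟩
    have h0 : 0 < min 1 (η / (m + 1)) := by positivity
    have h1 : min 1 (η / (m + 1)) * (m + 1) ≤ η :=
      (le_div_iff₀ (by positivity)).1 (min_le_right _ _)
    have h2 : min 1 (η / (m + 1)) ^ 2 ≤ min 1 (η / (m + 1)) :=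
      pow_le_of_le_one h0.le (min_le_left _ _) two_ne_zero
    nlinarith
  have h4 : s ^ 4 ≤ 1 := pow_le_one₀ hs0.le hs1
  have h40 : 0 < s ^ 4 := pow_pos hs0 4
  refine l2Dist_le_of_cutoff hn g₀ g₁ φ hφ hEo.measurableSet hφE hs0 hs1 ε
    fun t ht g' h hg' hh => ?_
  have hφm : Measurable φ := φ.contMDiff.continuous.measurable
  have hvol : ENNReal.ofReal (s ^ 2) * riemannianVolume g₀ univ ≤ η := by
    rw [← ENNReal.ofReal_toReal (riemannianVolume_univ_lt_top g₀).ne,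
      ← ENNReal.ofReal_mul (by positivity), ENNReal.ofReal_le_iff_le_toReal ENNReal.coe_ne_top]
    exact hsm
  calc ENNReal.ofReal (l2Norm g' h)
      ≤ (∫⁻ x, ‖trInner g' h h x‖ₑ ∂riemannianVolume g') ^ (1 / 2 : ℝ) := ofReal_l2Norm_le g' h
    _ ≤ ((ε : ℝ≥0∞) ^ (2 : ℝ)) ^ (1 / 2 : ℝ) := by
        refine ENNReal.rpow_le_rpow ?_ (by norm_num)
        refine (hB _ t g' h (by fun_prop) (fun x => ?_) (fun x => ?_) ht hg' hh).trans ?_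
        · nlinarith [(hφ x).1, (hφ x).2]
        · nlinarith [(hφ x).1]
        calc (B : ℝ≥0∞) * ∫⁻ x in E, ENNReal.ofReal √(1 + (s ^ 4 - 1) * φ x)
              ∂riemannianVolume g₀ ≤ B * (η + η) := by
              gcongr
              exact (setLIntegral_sqrt_factor_le _ hEo.measurableSet hK.measurableSet hφ hφK
                hs0 hs1).trans (add_le_add hvol hEK.le)
          _ ≤ (ε : ℝ≥0∞) ^ (2 : ℝ) := by
              rw [ENNReal.rpow_ofNat]
              norm_cast
              calc B * (η + η) ≤ (B + 1) * (η + η) := by gcongr; exact le_self_add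
                _ = ε ^ 2 := by
                    rw [hη]
                    field_simp
                    ring
    _ = ε := by
        rw [← ENNReal.rpow_mul]
        norm_num

end Main

end L2Metric

theorem mainTheorem3 (n : ℕ) :
    ∃ C : ℝ≥0, ∀ (M : Type*) [TopologicalSpace M] [T2Space M] [CompactSpace M]
      [ChartedSpace (EuclideanSpace ℝ (Fin n)) M] [IsManifold (𝓡 n) ∞ M]
      [MeasurableSpace M] [BorelSpace M],
      (∀ g₀ g₁ : L2Metric.Metrics n M,
        L2Metric.l2Dist g₀ g₁ ≤
          C * ((L2Metric.riemannianVolume g₀ {x | g₀.inner x ≠ g₁.inner x}) ^ (1 / 2 : ℝ) +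
            (L2Metric.riemannianVolume g₁ {x | g₀.inner x ≠ g₁.inner x}) ^ (1 / 2 : ℝ))) ∧
      ∀ δ : ℝ≥0,
        L2Metric.l2Diam {g : L2Metric.Metrics n M | L2Metric.riemannianVolume g univ ≤ δ} ≤
          2 * C * (δ : ℝ≥0∞) ^ (1 / 2 : ℝ) := by
  refine ⟨4 * NNReal.sqrt n, fun M _ _ _ _ _ _ _ => ⟨L2Metric.l2Dist_le_volume, fun δ => ?_⟩⟩
  refine iSup₂_le fun g₀ hg₀ => iSup₂_le fun g₁ hg₁ => ?_
  refine (L2Metric.l2Dist_le_volume g₀ g₁).trans ?_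
  rw [mul_comm 2, mul_assoc, two_mul]
  gcongr
  · exact (measure_mono (subset_univ _)).trans hg₀
  · exact (measure_mono (subset_univ _)).trans hg₁
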